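/- Let $q\colon\mathbb R\to[0,\infty)$ be a continuous, compactly supported probability density which is symmetric, $q(-x)=q(x)$ for all $x$. Consider the branching random walk on the infinite rooted ternary tree: every vertex $v$ has exactly three children, the edges carry i.i.d. random increments with density $q$, and $S_v$ is the sum of the increments along the path from the root $o$ to $v$ (so $S_o=0$). For $n\ge 0$ define values $\varphi_n(v)$ on the vertices of generation at most $n$ as follows: $\varphi_n(v)=S_v$ if $v$ is in generation $n$, and, recursively, if $v$ is in a generation less than $n$ then $\varphi_n(v)$ is the middle one (the median, i.e. the second in increasing order) of the three values of $\varphi_n$ at the children of $v$. Put $M_n:=\varphi_n(o)$. Then there is a set $I\subseteq\mathbb N$ such that the family of random variables $(M_n)_{n\in I}$ is tight and $$\liminf_{n\to\infty}\frac{|I\cap\{1,\dots,n\}|}{n}>0.$$ -/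

import Mathlib

open MeasureTheory ProbabilityTheory Filter

namespace TernaryVoting

/-- Vertices of the infinite rooted ternary tree: the root is `[]`, and the three children of `v`
are `i :: v` for `i : Fin 3`, so the generation of `v` is `v.length`. -/
abbrev Vertex : Type := List (Fin 3)

/-- Edges of the tree: `(v, i)` is the edge from `v` to its child `i :: v`. -/
abbrev Edge : Type := Vertex × Fin 3

/-- Position of the particle `v` when the walk starts at `0`: the sum of the increments `x` along
the edges of the path from the root to `v`. -/
noncomputable def position (x : Edge → ℝ) : Vertex → ℝ
  | [] => 0
  | i :: v => position x v + x (v, i)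

/-- The second of three values listed in increasing order. -/
noncomputable def middle (a : Fin 3 → ℝ) : ℝ := a (Tuple.sort a 1)

/-- `vote x m v` is the value assigned to the vertex `v` when the final generation is
`v.length + m`: a vertex of the final generation gets its position, and every other vertex gets
the middle one of the values of its three children. -/
noncomputable def vote (x : Edge → ℝ) : ℕ → Vertex → ℝ
  | 0, v => position x v
  | m + 1, v => middle fun i => vote x m (i :: v)

/-- The result of the vote at the root when the final generation is `n`. -/
noncomputable def result (x : Edge → ℝ) (n : ℕ) : ℝ := vote x n []

/-- A continuous, compactly supported probability density on the line. -/
structure IsJumpDensity (q : ℝ → ℝ) : Prop where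
  continuous : Continuous q
  hasCompactSupport : HasCompactSupport q
  nonneg : ∀ y, 0 ≤ q y
  integral_eq_one : ∫ y, q y = 1

/-- The increments `X e`, over the edges `e` of the tree, are independent random variables, each
with density `q`; the positions then form a branching random walk with ternary branching. -/
structure IsIncrementField {Ω : Type*} [MeasurableSpace Ω] (P : Measure Ω) (q : ℝ → ℝ)
    (X : Edge → Ω → ℝ) : Prop where
  measurable : ∀ e, Measurable (X e)
  indep : iIndepFun X P
  law : ∀ e, P.map (X e) = volume.withDensity fun y => ENNReal.ofReal (q y)

/-- The random variable `M n`, the result of the vote in the branching random walk. -/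
noncomputable def M {Ω : Type*} (X : Edge → Ω → ℝ) (n : ℕ) (ω : Ω) : ℝ := result (fun e => X e ω) n

/-- Lower asymptotic density of a set of natural numbers. -/
noncomputable def lowerDensity (I : Set ℕ) : ℝ :=
  liminf (fun n : ℕ => ((I ∩ Set.Icc 1 n).ncard : ℝ) / n) atTop

end TernaryVoting

/-!
Let `w n` be the distribution function of the value proposed to a vertex by a child that is `n - 1`
generations above the final one, relative to the position of the vertex. A median of three is at
most `t` if and only if at least two of the three values are, so that `w (n + 1) = μ ∗ G (w n)` with
`μ` the law of the increments and `G s = 3 s ^ 2 - 2 s ^ 3`. Let `Φ` be the primitive of `G`, which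
is convex on `[0, 1]`. The energy `∫ (w n * G (w n) - Φ (w n) - Φ (w (n + 1)))` is nonincreasing in
`n`: convolution with the symmetric `μ` is self-adjoint, and `Φ` lies above its tangents. Since
`∫ (μ ∗ f - f) = 0`, Jensen's inequality for `Φ` bounds the energy from below by the integral of
`s * G s - Φ s - Φ (G s)` at `s = w n`, a function that is at least `s ^ 3 / 2` for
`0 ≤ s ≤ 1 / 2`. Monotonicity of `w n` then gives `A * w n (-A) ^ 3 / 2 ≤ energy at 0`, a tail bound
that is uniform in `n`.
-/

namespace TernaryVoting

section Median

theorem middle_le_iff (a : Fin 3 → ℝ) (t : ℝ) :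
    middle a ≤ t ↔ (a 0 ≤ t ∧ a 1 ≤ t) ∨ (a 0 ≤ t ∧ a 2 ≤ t) ∨ (a 1 ≤ t ∧ a 2 ≤ t) := by
  have hsort : middle a ≤ t ↔ 1 < Fintype.card {i // (a ∘ Tuple.sort a) i ≤ t} := by
    rw [Fintype.card_subtype]
    exact (Tuple.lt_card_le_iff_apply_le_of_monotone (j := 1) (Tuple.monotone_sort a)).symm
  have hperm : Fintype.card {i // (a ∘ Tuple.sort a) i ≤ t} = Fintype.card {i // a i ≤ t} :=
    Fintype.card_congr ((Tuple.sort a).subtypeEquiv fun _ => Iff.rfl)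
  rw [hsort, hperm, Fintype.card_subtype, Finset.card_filter, Fin.sum_univ_three]
  split_ifs <;> simp_all

theorem middle_const_add (c : ℝ) (a : Fin 3 → ℝ) : middle (fun i => c + a i) = c + middle a :=
  eq_of_forall_ge_iff fun t => by
    simp only [← le_sub_iff_add_le', middle_le_iff]

theorem measurable_middle : Measurable middle := by
  refine measurable_of_Iic fun t => ?_
  simp only [Set.preimage, Set.mem_Iic, middle_le_iff]
  measurability

end Median

section Majority

/-- The probability that at least two of three independent events of probability `s` occur. -/
def majority (s : ℝ) : ℝ := 3 * s ^ 2 - 2 * s ^ 3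

/-- The primitive of `majority` vanishing at `0`. -/
noncomputable def primitive (s : ℝ) : ℝ := s ^ 3 - s ^ 4 / 2

/-- The Legendre transform of `primitive`, as a function of the point `s` at which the slope of
`primitive` is taken. -/
noncomputable def legendre (s : ℝ) : ℝ := s * majority s - primitive s

/-- The lower bound for the energy density of the voting scheme: it vanishes at `0` and `1` and is
positive in between. -/
noncomputable def potential (s : ℝ) : ℝ := legendre s - primitive (majority s)

variable {s t : ℝ}

@[fun_prop]
theorem continuous_majority : Continuous majority := by unfold majority; fun_prop

@[fun_prop]
theorem continuous_primitive : Continuous primitive := by unfold primitive; fun_prop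

@[fun_prop]
theorem continuous_legendre : Continuous legendre := by unfold legendre; fun_prop

@[simp] theorem majority_zero : majority 0 = 0 := by norm_num [majority]

@[simp] theorem majority_one : majority 1 = 1 := by norm_num [majority]

@[simp] theorem primitive_zero : primitive 0 = 0 := by norm_num [primitive]

@[simp] theorem primitive_one : primitive 1 = 1 / 2 := by norm_num [primitive]

theorem majority_one_sub (s : ℝ) : majority (1 - s) = 1 - majority s := by
  unfold majority; ring

theorem hasDerivAt_primitive (s : ℝ) : HasDerivAt primitive (majority s) s := by
  refine ((hasDerivAt_pow 3 s).sub ((hasDerivAt_pow 4 s).div_const 2)).congr_deriv ?_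
  unfold majority
  norm_num
  ring

theorem monotoneOn_majority : MonotoneOn majority (Set.Icc 0 1) := by
  intro s hs t ht hst
  have hdiff : majority t - majority s =
      (t - s) * (3 * (s * (1 - s)) + 3 * (t * (1 - t)) + (t - s) ^ 2) := by
    unfold majority; ring
  have hs' := mul_nonneg hs.1 (sub_nonneg.2 hs.2)
  have ht' := mul_nonneg ht.1 (sub_nonneg.2 ht.2)
  rw [← sub_nonneg, hdiff]
  exact mul_nonneg (sub_nonneg.2 hst) (by positivity)

theorem majority_mem_Icc (hs : s ∈ Set.Icc 0 1) : majority s ∈ Set.Icc 0 1 := by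
  have h0 := monotoneOn_majority (Set.left_mem_Icc.2 zero_le_one) hs hs.1
  have h1 := monotoneOn_majority hs (Set.right_mem_Icc.2 zero_le_one) hs.2
  rw [majority_zero] at h0
  rw [majority_one] at h1
  exact ⟨h0, h1⟩

theorem majority_le_self (h0 : 0 ≤ s) (h1 : s ≤ 1 / 2) : majority s ≤ s := by
  have hdiff : s - majority s = s * ((1 - s) * (1 - 2 * s)) := by unfold majority; ring
  rw [← sub_nonneg, hdiff]
  exact mul_nonneg h0 (mul_nonneg (by linarith) (by linarith))

theorem convexOn_primitive : ConvexOn ℝ (Set.Icc 0 1) primitive := by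
  have hderiv : deriv primitive = majority := funext fun s => (hasDerivAt_primitive s).deriv
  refine MonotoneOn.convexOn_of_deriv (convex_Icc 0 1) continuous_primitive.continuousOn
    (fun s _ => (hasDerivAt_primitive s).differentiableAt.differentiableWithinAt) ?_
  rw [hderiv]
  exact monotoneOn_majority.mono interior_subset

theorem monotoneOn_primitive : MonotoneOn primitive (Set.Icc 0 1) := by
  refine monotoneOn_of_hasDerivWithinAt_nonneg (convex_Icc 0 1) continuous_primitive.continuousOn
    (fun s _ => (hasDerivAt_primitive s).hasDerivWithinAt) fun s hs => ?_
  exact (majority_mem_Icc (interior_subset hs)).1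

theorem tangent_le_of_convexOn {f : ℝ → ℝ} {f' : ℝ} {S : Set ℝ} (hf : ConvexOn ℝ S f) (hs : s ∈ S)
    (ht : t ∈ S) (hf' : HasDerivAt f f' s) : f s + f' * (t - s) ≤ f t := by
  rcases lt_trichotomy s t with hst | rfl | hst
  · have h := hf.le_slope_of_hasDerivAt hs ht hst hf'
    rw [slope_def_field, le_div_iff₀ (sub_pos.2 hst)] at h
    linarith
  · simp
  · have h := hf.slope_le_of_hasDerivAt ht hs hst hf'
    rw [slope_def_field, div_le_iff₀ (sub_pos.2 hst)] at h
    linarith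

@[fun_prop]
theorem continuous_potential : Continuous potential := by unfold potential; fun_prop

@[simp] theorem legendre_zero : legendre 0 = 0 := by simp [legendre]

@[simp] theorem legendre_one : legendre 1 = 1 / 2 := by norm_num [legendre]

@[simp] theorem potential_zero : potential 0 = 0 := by simp [potential]

theorem potential_one_sub (s : ℝ) : potential (1 - s) = potential s := by
  unfold potential legendre
  rw [majority_one_sub]
  unfold primitive majority
  ring

@[simp] theorem potential_one : potential 1 = 0 := by simp [potential]

theorem cube_le_potential (h0 : 0 ≤ s) (h1 : s ≤ 1 / 2) : s ^ 3 / 2 ≤ potential s := by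
  have hs : s ∈ Set.Icc (0 : ℝ) 1 := ⟨h0, by linarith⟩
  have hprimitive : primitive (majority s) ≤ primitive s :=
    monotoneOn_primitive (majority_mem_Icc hs) hs (majority_le_self h0 h1)
  have hlegendre : legendre s - primitive s - s ^ 3 / 2 = s ^ 3 * (1 / 2 - s) := by
    unfold legendre majority primitive; ring
  have := mul_nonneg (pow_nonneg h0 3) (sub_nonneg.2 h1)
  unfold potential
  linarith

theorem potential_nonneg (hs : s ∈ Set.Icc 0 1) : 0 ≤ potential s := by
  wlog h : s ≤ 1 / 2 generalizing s
  · rw [← potential_one_sub]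
    exact this ⟨sub_nonneg.2 hs.2, sub_le_self 1 hs.1⟩ (by linarith)
  · exact (div_nonneg (pow_nonneg hs.1 3) zero_le_two).trans (cube_le_potential hs.1 h)

end Majority

section IsConstAtEnds

/-- A bounded measurable function on the line that is equal to `c` near `-∞` and to `d` near `∞`:
a class closed under products and convolution with compactly supported laws. -/
structure IsConstAtEnds (f : ℝ → ℝ) (c d : ℝ) : Prop where
  measurable : Measurable f
  bounded : ∃ B, ∀ x, |f x| ≤ B
  atBot : f =ᶠ[atBot] fun _ => c
  atTop : f =ᶠ[atTop] fun _ => d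

variable {f g : ℝ → ℝ} {c d c' d' : ℝ}

theorem isConstAtEnds_const (c : ℝ) : IsConstAtEnds (fun _ => c) c c where
  measurable := measurable_const
  bounded := ⟨|c|, fun _ => le_rfl⟩
  atBot := .rfl
  atTop := .rfl

namespace IsConstAtEnds

theorem comp (hf : IsConstAtEnds f c d) {φ : ℝ → ℝ} (hφ : Continuous φ) :
    IsConstAtEnds (fun x => φ (f x)) (φ c) (φ d) where
  measurable := hφ.measurable.comp hf.measurable
  bounded := by
    obtain ⟨B, hB⟩ := hf.bounded
    obtain ⟨C, hC⟩ :=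
      isCompact_Icc.exists_bound_of_continuousOn (hφ.continuousOn (s := Set.Icc (-B) B))
    exact ⟨C, fun x => hC _ (abs_le.1 (hB x))⟩
  atBot := hf.atBot.fun_comp φ
  atTop := hf.atTop.fun_comp φ

theorem sub (hf : IsConstAtEnds f c d) (hg : IsConstAtEnds g c' d') :
    IsConstAtEnds (fun x => f x - g x) (c - c') (d - d') where
  measurable := hf.measurable.sub hg.measurable
  bounded := by
    obtain ⟨B, hB⟩ := hf.bounded
    obtain ⟨B', hB'⟩ := hg.bounded
    exact ⟨B + B', fun x => (abs_sub _ _).trans (add_le_add (hB x) (hB' x))⟩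
  atBot := hf.atBot.sub hg.atBot
  atTop := hf.atTop.sub hg.atTop

theorem mul (hf : IsConstAtEnds f c d) (hg : IsConstAtEnds g c' d') :
    IsConstAtEnds (fun x => f x * g x) (c * c') (d * d') where
  measurable := hf.measurable.mul hg.measurable
  bounded := by
    obtain ⟨B, hB⟩ := hf.bounded
    obtain ⟨B', hB'⟩ := hg.bounded
    refine ⟨B * B', fun x => (abs_mul _ _).trans_le ?_⟩
    exact mul_le_mul (hB x) (hB' x) (abs_nonneg _) ((abs_nonneg _).trans (hB x))
  atBot := hf.atBot.mul hg.atBot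
  atTop := hf.atTop.mul hg.atTop

theorem integrable (hf : IsConstAtEnds f 0 0) : Integrable f := by
  obtain ⟨B, hB⟩ := hf.bounded
  obtain ⟨a, ha⟩ := eventually_atBot.1 hf.atBot
  obtain ⟨b, hb⟩ := eventually_atTop.1 hf.atTop
  have hon : IntegrableOn f (Set.Icc a b) :=
    Measure.integrableOn_of_bounded (by simp) hf.measurable.aestronglyMeasurable (ae_of_all _ hB)
  refine hon.integrable_of_forall_notMem_eq_zero fun x hx => ?_
  rcases not_and_or.1 hx with hx | hx
  · exact ha x (not_le.1 hx).le
  · exact hb x (not_le.1 hx).le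

theorem integrable_translate (hf : IsConstAtEnds f c d) (μ : Measure ℝ) [IsFiniteMeasure μ]
    (x : ℝ) : Integrable (fun y => f (x - y)) μ := by
  obtain ⟨B, hB⟩ := hf.bounded
  exact .of_bound (hf.measurable.comp (measurable_const.sub measurable_id)).aestronglyMeasurable B
    (ae_of_all _ fun y => hB _)

theorem eventually_atBot_translate (hf : IsConstAtEnds f c d) (R : ℝ) :
    ∀ᶠ x in Filter.atBot, ∀ y, |y| ≤ R → f (x - y) = c := by
  obtain ⟨A, hA⟩ := eventually_atBot.1 hf.atBot
  filter_upwards [eventually_le_atBot (A - R)] with x hx y hy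
  exact hA _ (by linarith [neg_le_of_abs_le hy])

theorem eventually_atTop_translate (hf : IsConstAtEnds f c d) (R : ℝ) :
    ∀ᶠ x in Filter.atTop, ∀ y, |y| ≤ R → f (x - y) = d := by
  obtain ⟨A, hA⟩ := eventually_atTop.1 hf.atTop
  filter_upwards [eventually_ge_atTop (A + R)] with x hx y hy
  exact hA _ (by linarith [le_of_abs_le hy])

end IsConstAtEnds

end IsConstAtEnds

section Smear

/-- The convolution of a function with the jump law `μ`: the expectation of `f (x - Y)`, where `Y`
has law `μ`. -/
noncomputable def smear (μ : Measure ℝ) (f : ℝ → ℝ) (x : ℝ) : ℝ := ∫ y, f (x - y) ∂μ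

theorem measurable_smear {μ : Measure ℝ} [SFinite μ] {f : ℝ → ℝ} (hf : Measurable f) :
    Measurable (smear μ f) := by
  have : Measurable (Function.uncurry fun x y : ℝ => f (x - y)) := hf.comp measurable_sub
  exact this.stronglyMeasurable.integral_prod_right.measurable

theorem smear_eq_integral_add (μ : Measure ℝ) [μ.IsNegInvariant] (f : ℝ → ℝ) (x : ℝ) :
    smear μ f x = ∫ y, f (x + y) ∂μ := by
  rw [smear, ← integral_neg_eq_self]
  simp only [sub_neg_eq_add]

theorem integrable_prod_of_bounded {α β : Type*} [MeasurableSpace α] [MeasurableSpace β]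
    {ν : Measure α} {μ : Measure β} [SFinite ν] [IsFiniteMeasure μ] {k : α × β → ℝ} {B : ℝ}
    {s : Set α} (hk : Measurable k) (hB : ∀ p, |k p| ≤ B) (hs : ν s ≠ ⊤)
    (hks : ∀ᵐ y ∂μ, ∀ x ∉ s, k (x, y) = 0) : Integrable k (ν.prod μ) := by
  have hon : IntegrableOn k (s ×ˢ Set.univ) (ν.prod μ) := by
    refine Measure.integrableOn_of_bounded (M := B) ?_ hk.aestronglyMeasurable (ae_of_all _ hB)
    rw [Measure.prod_prod]
    exact ENNReal.mul_ne_top hs (measure_ne_top μ _)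
  refine hon.integrable_of_ae_notMem_eq_zero ?_
  filter_upwards [Measure.quasiMeasurePreserving_snd.ae hks] with p hp hps
  exact hp p.1 fun h => hps ⟨h, trivial⟩

variable {μ : Measure ℝ} [IsProbabilityMeasure μ] {f g : ℝ → ℝ} {c d c' d' R : ℝ}

theorem smear_const (c x : ℝ) : smear μ (fun _ => c) x = c := by simp [smear]

theorem IsConstAtEnds.smear (hf : IsConstAtEnds f c d) (hR : ∀ᵐ y ∂μ, |y| ≤ R) :
    IsConstAtEnds (smear μ f) c d where
  measurable := measurable_smear hf.measurable
  bounded := by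
    obtain ⟨B, hB⟩ := hf.bounded
    refine ⟨B, fun x => ?_⟩
    simpa [TernaryVoting.smear] using norm_integral_le_of_norm_le_const (μ := μ)
      (f := fun y => f (x - y)) (ae_of_all _ fun y => hB (x - y))
  atBot := by
    filter_upwards [hf.eventually_atBot_translate R] with x hx
    exact (integral_congr_ae (hR.mono hx)).trans (smear_const c x)
  atTop := by
    filter_upwards [hf.eventually_atTop_translate R] with x hx
    exact (integral_congr_ae (hR.mono hx)).trans (smear_const d x)

theorem integrable_smear_kernel (hf : IsConstAtEnds f c d) (hg : IsConstAtEnds g c' d')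
    (hR : ∀ᵐ y ∂μ, |y| ≤ R) :
    Integrable (fun p : ℝ × ℝ => f (p.1 - p.2) * g p.1 - f p.1 * g (p.1 - p.2))
      (volume.prod μ) := by
  obtain ⟨B, hB⟩ := hf.bounded
  obtain ⟨B', hB'⟩ := hg.bounded
  obtain ⟨a, ha⟩ := eventually_atBot.1 ((hf.eventually_atBot_translate R).and
    ((hg.eventually_atBot_translate R).and (hf.atBot.and hg.atBot)))
  obtain ⟨b, hb⟩ := eventually_atTop.1 ((hf.eventually_atTop_translate R).and
    ((hg.eventually_atTop_translate R).and (hf.atTop.and hg.atTop)))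
  refine integrable_prod_of_bounded (B := B * B' + B * B') (s := Set.Icc a b) ?_ ?_ (by simp) ?_
  · exact ((hf.measurable.comp measurable_sub).mul (hg.measurable.comp measurable_fst)).sub
      ((hf.measurable.comp measurable_fst).mul (hg.measurable.comp measurable_sub))
  · have hmul (x z : ℝ) : |f x * g z| ≤ B * B' := (abs_mul _ _).trans_le
      (mul_le_mul (hB x) (hB' z) (abs_nonneg _) ((abs_nonneg _).trans (hB x)))
    exact fun p => (abs_sub _ _).trans (add_le_add (hmul _ _) (hmul _ _))
  · filter_upwards [hR] with y hy x hx
    rcases not_and_or.1 hx with hx | hx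
    · obtain ⟨hfy, hgy, hf0, hg0⟩ := ha x (not_le.1 hx).le
      rw [hfy y hy, hgy y hy, hf0, hg0, sub_self]
    · obtain ⟨hfy, hgy, hf0, hg0⟩ := hb x (not_le.1 hx).le
      rw [hfy y hy, hgy y hy, hf0, hg0, sub_self]

-- Self-adjointness of `smear μ`; neither product need be integrable on its own, so the identity
-- cannot be stated as an equality of two integrals.
theorem integral_smear_mul_sub_mul_smear [μ.IsNegInvariant] (hf : IsConstAtEnds f c d)
    (hg : IsConstAtEnds g c' d') (hR : ∀ᵐ y ∂μ, |y| ≤ R) :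
    ∫ x, (smear μ f x * g x - f x * smear μ g x) = 0 := by
  let k : ℝ → ℝ → ℝ := fun x y => f (x - y) * g x - f x * g (x - y)
  have hfubini : ∫ x, (smear μ f x * g x - f x * smear μ g x) = ∫ y, (∫ x, k x y) ∂μ := by
    rw [← integral_integral_swap (integrable_smear_kernel hf hg hR)]
    congr 1 with x
    rw [integral_sub ((hf.integrable_translate μ x).mul_const _)
      ((hg.integrable_translate μ x).const_mul _), integral_mul_const, integral_const_mul]
    rfl
  have hodd (y : ℝ) : ∫ x, k x (-y) = -∫ x, k x y := by
    rw [← integral_neg, ← integral_sub_right_eq_self _ y]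
    congr 1 with x
    simp only [k, sub_neg_eq_add, sub_add_cancel]
    ring
  have hneg : -∫ y, (∫ x, k x y) ∂μ = ∫ y, (∫ x, k x y) ∂μ := by
    rw [← integral_neg, ← integral_neg_eq_self (fun y => ∫ x, k x y) μ]
    simp only [hodd]
  rw [hfubini]
  linarith

theorem integral_smear_sub [μ.IsNegInvariant] (hf : IsConstAtEnds f c d)
    (hR : ∀ᵐ y ∂μ, |y| ≤ R) : ∫ x, (smear μ f x - f x) = 0 := by
  simpa [smear_const] using integral_smear_mul_sub_mul_smear hf (isConstAtEnds_const 1) hR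

theorem map_smear_le_smear_of_convexOn (hf : IsConstAtEnds f c d) {φ : ℝ → ℝ} {s : Set ℝ}
    (hφ : ConvexOn ℝ s φ) (hcont : Continuous φ) (hs : IsClosed s) (hfs : ∀ x, f x ∈ s) (x : ℝ) :
    φ (smear μ f x) ≤ smear μ (fun z => φ (f z)) x :=
  hφ.map_integral_le hcont.continuousOn hs (ae_of_all _ fun _ => hfs _)
    (hf.integrable_translate μ x) ((hf.comp hcont).integrable_translate μ x)

end Smear

section IsSymmCdf

/-- A distribution function of a compactly supported law on the line that is symmetric about `0`.
Symmetry is recorded by its two consequences for the values of `f` at pairs of points on either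
side of reflection, which allows atoms; right-continuity is not recorded. -/
structure IsSymmCdf (f : ℝ → ℝ) : Prop where
  monotone : Monotone f
  atBot : f =ᶠ[atBot] fun _ => 0
  atTop : f =ᶠ[atTop] fun _ => 1
  one_le_add : ∀ x y, 0 ≤ x + y → 1 ≤ f x + f y
  add_le_one : ∀ x y, x + y < 0 → f x + f y ≤ 1

theorem isSymmCdf_indicator_Ici : IsSymmCdf ((Set.Ici (0 : ℝ)).indicator 1) where
  monotone x y hxy := by
    simp only [Set.indicator_apply, Set.mem_Ici, Pi.one_apply]
    split_ifs <;> linarith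
  atBot := by
    filter_upwards [eventually_lt_atBot 0] with x hx
    exact Set.indicator_of_notMem (not_le.2 hx) _
  atTop := by
    filter_upwards [eventually_ge_atTop 0] with x hx
    exact Set.indicator_of_mem hx _
  one_le_add x y hxy := by
    simp only [Set.indicator_apply, Set.mem_Ici, Pi.one_apply]
    split_ifs <;> linarith
  add_le_one x y hxy := by
    simp only [Set.indicator_apply, Set.mem_Ici, Pi.one_apply]
    split_ifs <;> linarith

namespace IsSymmCdf

variable {f : ℝ → ℝ}

theorem mem_Icc (hf : IsSymmCdf f) (x : ℝ) : f x ∈ Set.Icc 0 1 := by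
  obtain ⟨y, hy, hyx⟩ := (hf.atBot.and (eventually_le_atBot x)).exists
  obtain ⟨z, hz, hxz⟩ := (hf.atTop.and (eventually_ge_atTop x)).exists
  exact ⟨hy.symm.trans_le (hf.monotone hyx), (hf.monotone hxz).trans_eq hz⟩

theorem le_half (hf : IsSymmCdf f) {x : ℝ} (hx : x < 0) : f x ≤ 1 / 2 := by
  linarith [hf.add_le_one x x (by linarith)]

theorem isConstAtEnds (hf : IsSymmCdf f) : IsConstAtEnds f 0 1 where
  measurable := hf.monotone.measurable
  bounded := ⟨1, fun x => abs_le.2 ⟨by linarith [(hf.mem_Icc x).1], (hf.mem_Icc x).2⟩⟩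
  atBot := hf.atBot
  atTop := hf.atTop

theorem majority_comp (hf : IsSymmCdf f) : IsSymmCdf fun x => majority (f x) where
  monotone x y hxy := monotoneOn_majority (hf.mem_Icc x) (hf.mem_Icc y) (hf.monotone hxy)
  atBot := hf.atBot.mono fun x hx => by simp only [hx, majority_zero]
  atTop := hf.atTop.mono fun x hx => by simp only [hx, majority_one]
  one_le_add x y hxy := by
    have h := monotoneOn_majority
      ⟨sub_nonneg.2 (hf.mem_Icc y).2, sub_le_self _ (hf.mem_Icc y).1⟩ (hf.mem_Icc x)
      (sub_le_iff_le_add.2 (hf.one_le_add x y hxy))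
    rw [majority_one_sub] at h
    linarith
  add_le_one x y hxy := by
    have h := monotoneOn_majority (hf.mem_Icc x)
      ⟨sub_nonneg.2 (hf.mem_Icc y).2, sub_le_self _ (hf.mem_Icc y).1⟩
      (le_sub_iff_add_le.2 (hf.add_le_one x y hxy))
    rw [majority_one_sub] at h
    linarith

theorem smear {μ : Measure ℝ} [IsProbabilityMeasure μ] [μ.IsNegInvariant] {R : ℝ}
    (hf : IsSymmCdf f) (hR : ∀ᵐ y ∂μ, |y| ≤ R) : IsSymmCdf (smear μ f) := by
  have hends := hf.isConstAtEnds.smear hR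
  have hint := hf.isConstAtEnds.integrable_translate μ
  have hint' (x : ℝ) : Integrable (fun y => f (x + y)) μ := by
    simpa only [sub_neg_eq_add] using (hint x).comp_neg
  have hadd (x y : ℝ) : TernaryVoting.smear μ f x + TernaryVoting.smear μ f y =
      ∫ z, (f (x - z) + f (y + z)) ∂μ := by
    rw [smear_eq_integral_add μ f y, integral_add (hint x) (hint' y), TernaryVoting.smear]
  refine ⟨fun x y hxy => ?_, hends.atBot, hends.atTop, fun x y hxy => ?_, fun x y hxy => ?_⟩
  · exact integral_mono (hint x) (hint y) fun z => hf.monotone (sub_le_sub_right hxy z)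
  · rw [hadd, ← smear_const (μ := μ) 1 x]
    exact integral_mono (integrable_const 1) ((hint x).add (hint' y)) fun z =>
      hf.one_le_add _ _ (by linarith)
  · rw [hadd, ← smear_const (μ := μ) 1 x]
    exact integral_mono ((hint x).add (hint' y)) (integrable_const 1) fun z =>
      hf.add_le_one _ _ (by linarith)

theorem integrable_potential (hf : IsSymmCdf f) : Integrable fun x => potential (f x) := by
  have h := hf.isConstAtEnds.comp continuous_potential
  rw [potential_zero, potential_one] at h
  exact h.integrable

-- On `[-A, 0)` the value of `f` lies between `f (-A)` and `1 / 2`.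
theorem mul_cube_le_integral_potential (hf : IsSymmCdf f) {A : ℝ} (hA : 0 ≤ A) :
    A * (f (-A) ^ 3 / 2) ≤ ∫ x, potential (f x) := by
  have hlower (x : ℝ) (hx : x ∈ Set.Ico (-A) 0) : f (-A) ^ 3 / 2 ≤ potential (f x) :=
    (div_le_div_of_nonneg_right (pow_le_pow_left₀ (hf.mem_Icc _).1 (hf.monotone hx.1) 3)
      zero_le_two).trans (cube_le_potential (hf.mem_Icc x).1 (hf.le_half hx.2))
  calc A * (f (-A) ^ 3 / 2) = f (-A) ^ 3 / 2 * volume.real (Set.Ico (-A) 0) := by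
        simp [hA, mul_comm]
    _ ≤ ∫ x in Set.Ico (-A) 0, potential (f x) :=
        setIntegral_ge_of_const_le_real measurableSet_Ico (by simp) hlower
          hf.integrable_potential.integrableOn
    _ ≤ ∫ x, potential (f x) := setIntegral_le_integral hf.integrable_potential
        (ae_of_all _ fun x => potential_nonneg (hf.mem_Icc x))

end IsSymmCdf

end IsSymmCdf

section Energy

/-- The distribution function of the value proposed to a vertex by a child that is `n - 1`
generations above the final one, relative to the position of the vertex, when the increments have
law `μ`. The Heaviside function at `n = 0` makes `majority (wave μ n x)` the distribution function
of the vote `n` generations above the final one for every `n`. -/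
noncomputable def wave (μ : Measure ℝ) : ℕ → ℝ → ℝ
  | 0 => (Set.Ici 0).indicator 1
  | n + 1 => smear μ fun x => majority (wave μ n x)

/-- The energy of the pair of consecutive waves `wave μ n` and `wave μ (n + 1)`, which is
nonincreasing in `n` and controls the integral of `potential (wave μ n x)`. -/
noncomputable def energy (μ : Measure ℝ) (n : ℕ) : ℝ :=
  ∫ x, (legendre (wave μ n x) - primitive (wave μ (n + 1) x))

variable {μ : Measure ℝ} [IsProbabilityMeasure μ] [μ.IsNegInvariant] {R : ℝ}

theorem isSymmCdf_wave (hR : ∀ᵐ y ∂μ, |y| ≤ R) (n : ℕ) : IsSymmCdf (wave μ n) := by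
  induction n with
  | zero => exact isSymmCdf_indicator_Ici
  | succ n ih => exact ih.majority_comp.smear hR

theorem integrable_energy (hR : ∀ᵐ y ∂μ, |y| ≤ R) (n : ℕ) :
    Integrable fun x => legendre (wave μ n x) - primitive (wave μ (n + 1) x) := by
  have h := ((isSymmCdf_wave hR n).isConstAtEnds.comp continuous_legendre).sub
    ((isSymmCdf_wave hR (n + 1)).isConstAtEnds.comp continuous_primitive)
  simp only [legendre_zero, legendre_one, primitive_zero, primitive_one, sub_self] at h
  exact h.integrable

-- The tangent inequality for `primitive` between the waves `n` and `n + 2` bounds the difference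
-- of the two energy densities by an integrand whose integral vanishes by self-adjointness.
theorem energy_succ_le (hR : ∀ᵐ y ∂μ, |y| ≤ R) (n : ℕ) : energy μ (n + 1) ≤ energy μ n := by
  let δ : ℝ → ℝ := fun x => wave μ (n + 1) x * majority (wave μ (n + 1) x) -
    majority (wave μ n x) * wave μ (n + 2) x
  have hw (k : ℕ) := isSymmCdf_wave hR k
  have hends (k : ℕ) := (hw k).isConstAtEnds
  have hends' (k : ℕ) := (hw k).majority_comp.isConstAtEnds
  have hδ : ∫ x, δ x = 0 := integral_smear_mul_sub_mul_smear (hends' n) (hends' (n + 1)) hR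
  have hδ_int : Integrable δ := by
    have h := ((hends (n + 1)).mul (hends' (n + 1))).sub ((hends' n).mul (hends (n + 2)))
    rw [sub_self, sub_self] at h
    exact h.integrable
  have htangent (x : ℝ) : primitive (wave μ n x) +
      majority (wave μ n x) * (wave μ (n + 2) x - wave μ n x) ≤ primitive (wave μ (n + 2) x) :=
    tangent_le_of_convexOn convexOn_primitive ((hw n).mem_Icc x) ((hw (n + 2)).mem_Icc x)
      (hasDerivAt_primitive _)
  calc energy μ (n + 1) = energy μ (n + 1) - ∫ x, δ x := by rw [hδ, sub_zero]
    _ = ∫ x, (legendre (wave μ (n + 1) x) - primitive (wave μ (n + 2) x) - δ x) :=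
        (integral_sub (integrable_energy hR (n + 1)) hδ_int).symm
    _ ≤ energy μ n := by
        refine integral_mono ((integrable_energy hR (n + 1)).sub hδ_int)
          (integrable_energy hR n) fun x => ?_
        simp only [legendre, δ]
        linarith [htangent x]

theorem integral_potential_le_energy (hR : ∀ᵐ y ∂μ, |y| ≤ R) (n : ℕ) :
    ∫ x, potential (wave μ n x) ≤ energy μ n := by
  let g : ℝ → ℝ := fun x => primitive (majority (wave μ n x))
  have hw := isSymmCdf_wave hR n
  have hu := hw.majority_comp
  have hg : IsConstAtEnds g (primitive 0) (primitive 1) :=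
    hu.isConstAtEnds.comp continuous_primitive
  have hg_int : Integrable fun x => smear μ g x - g x := by
    have h := (hg.smear hR).sub hg
    rw [sub_self, sub_self] at h
    exact h.integrable
  have hjensen (x : ℝ) : primitive (wave μ (n + 1) x) ≤ smear μ g x :=
    map_smear_le_smear_of_convexOn hu.isConstAtEnds convexOn_primitive continuous_primitive
      isClosed_Icc hu.mem_Icc x
  calc ∫ x, potential (wave μ n x)
      = (∫ x, potential (wave μ n x)) - ∫ x, (smear μ g x - g x) := by
        rw [integral_smear_sub hg hR, sub_zero]
    _ = ∫ x, (potential (wave μ n x) - (smear μ g x - g x)) :=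
        (integral_sub hw.integrable_potential hg_int).symm
    _ ≤ energy μ n := by
        refine integral_mono (hw.integrable_potential.sub hg_int) (integrable_energy hR n)
          fun x => ?_
        simp only [potential, g]
        linarith [hjensen x]

theorem mul_cube_wave_le_energy_zero (hR : ∀ᵐ y ∂μ, |y| ≤ R) (n : ℕ) {A : ℝ} (hA : 0 ≤ A) :
    A * (wave μ n (-A) ^ 3 / 2) ≤ energy μ 0 :=
  calc A * (wave μ n (-A) ^ 3 / 2) ≤ ∫ x, potential (wave μ n x) :=
        (isSymmCdf_wave hR n).mul_cube_le_integral_potential hA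
    _ ≤ energy μ n := integral_potential_le_energy hR n
    _ ≤ energy μ 0 := antitone_nat_of_succ_le (energy_succ_le hR) n.zero_le

theorem wave_neg_le_rpow (hR : ∀ᵐ y ∂μ, |y| ≤ R) (n : ℕ) {A : ℝ} (hA : 0 < A) :
    wave μ n (-A) ≤ (2 * energy μ 0 / A) ^ (3⁻¹ : ℝ) := by
  have hcube : wave μ n (-A) ^ 3 ≤ 2 * energy μ 0 / A := by
    rw [le_div_iff₀ hA]
    linarith [mul_cube_wave_le_energy_zero hR n hA.le]
  have h0 := ((isSymmCdf_wave hR n).mem_Icc (-A)).1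
  calc wave μ n (-A) = (wave μ n (-A) ^ 3) ^ ((3 : ℕ)⁻¹ : ℝ) :=
        (Real.pow_rpow_inv_natCast h0 three_ne_zero).symm
    _ ≤ (2 * energy μ 0 / A) ^ ((3 : ℕ)⁻¹ : ℝ) :=
        Real.rpow_le_rpow (pow_nonneg h0 3) hcube (by positivity)

end Energy

section RelVote

/-- The value of `vote x n v` relative to the position of `v`. -/
noncomputable def relVote (x : Edge → ℝ) : ℕ → Vertex → ℝ
  | 0, _ => 0
  | n + 1, v => middle fun i => x (v, i) + relVote x n (i :: v)

/-- The value proposed to `v` by its child `i :: v`, relative to the position of `v`, when the child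
is `n` generations above the final one. -/
noncomputable def proposal (x : Edge → ℝ) (n : ℕ) (v : Vertex) (i : Fin 3) : ℝ :=
  x (v, i) + relVote x n (i :: v)

/-- The edges below the vertex `v`. -/
def edgesBelow (v : Vertex) : Set Edge := {e | v <:+ e.1}

/-- The edges of the branch of `v` that starts with the edge from `v` to its child `i :: v`. -/
def branch (v : Vertex) (i : Fin 3) : Set Edge := insert (v, i) (edgesBelow (i :: v))

theorem vote_eq_position_add_relVote (x : Edge → ℝ) (n : ℕ) (v : Vertex) :
    vote x n v = position x v + relVote x n v := by
  induction n generalizing v with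
  | zero => simp [vote, relVote]
  | succ n ih =>
    simp only [vote, relVote, ih, position, add_assoc]
    exact middle_const_add _ _

theorem M_eq_relVote {Ω : Type*} (X : Edge → Ω → ℝ) (n : ℕ) :
    M X n = fun ω => relVote (fun e => X e ω) n [] := by
  funext ω
  simp [M, result, vote_eq_position_add_relVote, position]

theorem branch_subset_edgesBelow (v : Vertex) (i : Fin 3) : branch v i ⊆ edgesBelow v := by
  rintro e (rfl | he)
  · exact List.suffix_rfl
  · exact (List.suffix_cons i v).trans he

theorem notMem_edgesBelow_cons (v : Vertex) (i j : Fin 3) : (v, j) ∉ edgesBelow (i :: v) :=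
  fun h => by simpa using List.IsSuffix.length_le h

theorem pairwise_disjoint_branch (v : Vertex) : Pairwise (Function.onFun Disjoint (branch v)) := by
  intro i j hij
  refine Set.disjoint_left.2 ?_
  rintro e (rfl | hi) (hj | hj)
  · exact hij (Prod.ext_iff.1 hj).2
  · exact notMem_edgesBelow_cons v j i hj
  · exact notMem_edgesBelow_cons v i j (hj ▸ hi)
  · have hcons := (List.suffix_of_suffix_length_le hi hj (by simp)).eq_of_length (by simp)
    exact hij (List.cons.inj hcons).1

variable {Ω : Type*} {m : MeasurableSpace Ω} {X : Edge → Ω → ℝ}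

theorem measurable_relVote (n : ℕ) {v : Vertex} (hX : ∀ e ∈ edgesBelow v, Measurable (X e)) :
    Measurable fun ω => relVote (fun e => X e ω) n v := by
  induction n generalizing v with
  | zero => exact measurable_const
  | succ n ih =>
    refine measurable_middle.comp (measurable_pi_lambda _ fun i => ?_)
    refine (hX _ (branch_subset_edgesBelow v i (Set.mem_insert _ _))).add (ih fun e he => ?_)
    exact hX e (branch_subset_edgesBelow v i (Set.mem_insert_of_mem _ he))

theorem measurable_proposal (n : ℕ) {v : Vertex} {i : Fin 3}
    (hX : ∀ e ∈ branch v i, Measurable (X e)) :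
    Measurable fun ω => proposal (fun e => X e ω) n v i :=
  (hX _ (Set.mem_insert _ _)).add
    (measurable_relVote n fun e he => hX e (Set.mem_insert_of_mem _ he))

theorem measurable_M (hX : ∀ e, Measurable (X e)) (n : ℕ) : Measurable (M X n) := by
  rw [M_eq_relVote]
  exact measurable_relVote n fun e _ => hX e

end RelVote

section Independence

variable {Ω ι : Type*} {_ : MeasurableSpace Ω} {P : Measure Ω}

theorem iIndep_biSup_of_pairwise_disjoint {κ : Type*} {m : ι → MeasurableSpace Ω}
    (h_le : ∀ i, m i ≤ ‹MeasurableSpace Ω›) (h_indep : iIndep m P) {S : κ → Set ι}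
    (hS : Pairwise (Function.onFun Disjoint S)) : iIndep (fun k => ⨆ i ∈ S k, m i) P := by
  have := h_indep.isProbabilityMeasure
  classical
  refine (iIndep_iff _ _).2 fun s => ?_
  induction s using Finset.cons_induction with
  | empty => simp
  | cons k s hk ih =>
    intro A hA
    have hAk := hA k (Finset.mem_cons_self k s)
    have hAs (l : κ) (hl : l ∈ s) := hA l (Finset.mem_cons_of_mem hl)
    have hdisj : Disjoint (S k) (⋃ l ∈ s, S l) :=
      Set.disjoint_iUnion₂_right.2 fun l hl => hS (ne_of_mem_of_not_mem hl hk).symm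
    have hle (l : κ) (hl : l ∈ s) : ⨆ i ∈ S l, m i ≤ ⨆ i ∈ ⋃ l ∈ s, S l, m i :=
      biSup_mono fun i hi => Set.mem_biUnion hl hi
    have hinter : MeasurableSet[⨆ i ∈ ⋃ l ∈ s, S l, m i] (⋂ l ∈ s, A l) :=
      @Finset.measurableSet_biInter _ _ (⨆ i ∈ ⋃ l ∈ s, S l, m i) _ _ fun l hl =>
        hle l hl _ (hAs l hl)
    rw [Finset.prod_cons, ← ih hAs, Finset.cons_eq_insert, Finset.set_biInter_insert]
    exact (Indep_iff _ _ _).1 (indep_iSup_of_disjoint h_le h_indep hdisj) _ _ hAk hinter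

theorem measureReal_add_le_eq_smear [IsFiniteMeasure P] {Y Z : Ω → ℝ} (hY : Measurable Y)
    (hZ : Measurable Z) (h : IndepFun Y Z P) (t : ℝ) :
    P.real {ω | Y ω + Z ω ≤ t} = smear (P.map Y) (fun s => P.real {ω | Z ω ≤ s}) t := by
  have hS : MeasurableSet {p : ℝ × ℝ | p.1 + p.2 ≤ t} :=
    measurableSet_le measurable_add measurable_const
  have hsection (y : ℝ) : P.map Z (Prod.mk y ⁻¹' {p : ℝ × ℝ | p.1 + p.2 ≤ t}) =
      P {ω | Z ω ≤ t - y} := by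
    rw [Measure.map_apply hZ (measurable_prodMk_left hS)]
    simp only [Set.preimage_ofPred_eq, le_sub_iff_add_le']
  have hanti : Antitone fun y => P {ω | Z ω ≤ t - y} := fun a b hab =>
    measure_mono fun ω (hω : Z ω ≤ t - b) => hω.trans (sub_le_sub_left hab t)
  have hfubini : P {ω | Y ω + Z ω ≤ t} = ∫⁻ y, P {ω | Z ω ≤ t - y} ∂(P.map Y) := by
    change P ((fun ω => (Y ω, Z ω)) ⁻¹' {p : ℝ × ℝ | p.1 + p.2 ≤ t}) = _
    rw [← Measure.map_apply (hY.prodMk hZ) hS, (indepFun_iff_map_prod_eq_prod_map_map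
      hY.aemeasurable hZ.aemeasurable).1 h, Measure.prod_apply hS]
    exact lintegral_congr hsection
  rw [Measure.real, hfubini]
  exact (integral_toReal hanti.measurable.aemeasurable
    (ae_of_all _ fun y => measure_lt_top _ _)).symm

theorem measureReal_two_of_three [IsFiniteMeasure P] {A : Fin 3 → Set Ω}
    (hA : ∀ i, MeasurableSet (A i)) :
    P.real (A 0 ∩ A 1 ∪ (A 0 ∩ A 2 ∪ A 1 ∩ A 2)) =
      P.real (A 0 ∩ A 1) + P.real (A 0 ∩ A 2) + P.real (A 1 ∩ A 2) -
        2 * P.real (A 0 ∩ (A 1 ∩ A 2)) := by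
  have hinter : A 0 ∩ A 1 ∩ (A 0 ∩ A 2 ∪ A 1 ∩ A 2) = A 0 ∩ (A 1 ∩ A 2) := by
    ext; simp only [Set.mem_inter_iff, Set.mem_union]; tauto
  have hinter' : A 0 ∩ A 2 ∩ (A 1 ∩ A 2) = A 0 ∩ (A 1 ∩ A 2) := by
    ext; simp only [Set.mem_inter_iff]; tauto
  have hunion := measureReal_union_add_inter (μ := P) (s := A 0 ∩ A 1)
    (((hA 0).inter (hA 2)).union ((hA 1).inter (hA 2)))
  have hunion' := measureReal_union_add_inter (μ := P) (s := A 0 ∩ A 2) ((hA 1).inter (hA 2))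
  rw [hinter] at hunion
  rw [hinter'] at hunion'
  linarith

theorem measureReal_middle_le {Z : Fin 3 → Ω → ℝ} (hZ : ∀ i, Measurable (Z i))
    (h : iIndepFun Z P) {t p : ℝ} (hp : ∀ i, P.real {ω | Z i ω ≤ t} = p) :
    P.real {ω | middle (fun i => Z i ω) ≤ t} = majority p := by
  have := h.isProbabilityMeasure
  let A (i : Fin 3) : Set Ω := {ω | Z i ω ≤ t}
  have hA (i : Fin 3) : MeasurableSet (A i) := measurableSet_le (hZ i) measurable_const
  have hinter (S : Finset (Fin 3)) : P.real (⋂ i ∈ S, A i) = p ^ S.card := by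
    have hprod : P (⋂ i ∈ S, A i) = ∏ i ∈ S, P (A i) :=
      h.meas_biInter fun i _ => ⟨Set.Iic t, measurableSet_Iic, rfl⟩
    rw [Measure.real, hprod, ENNReal.toReal_prod]
    exact Finset.prod_eq_pow_card fun i _ => hp i
  have h01 : P.real (A 0 ∩ A 1) = p ^ 2 := by simpa using hinter {0, 1}
  have h02 : P.real (A 0 ∩ A 2) = p ^ 2 := by simpa using hinter {0, 2}
  have h12 : P.real (A 1 ∩ A 2) = p ^ 2 := by simpa using hinter {1, 2}
  have h012 : P.real (A 0 ∩ (A 1 ∩ A 2)) = p ^ 3 := by simpa using hinter {0, 1, 2}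
  have hset : {ω | middle (fun i => Z i ω) ≤ t} = A 0 ∩ A 1 ∪ (A 0 ∩ A 2 ∪ A 1 ∩ A 2) :=
    Set.ext fun ω => middle_le_iff _ t
  rw [hset, measureReal_two_of_three hA, h01, h02, h12, h012]
  unfold majority
  ring

end Independence

section Law

/-- The σ-algebra generated by the increments along the edges in `S`. -/
abbrev sigmaEdges {Ω : Type*} (X : Edge → Ω → ℝ) (S : Set Edge) : MeasurableSpace Ω :=
  ⨆ e ∈ S, MeasurableSpace.comap (X e) inferInstance

variable {Ω : Type*} {X : Edge → Ω → ℝ}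

theorem measurable_sigmaEdges {S : Set Edge} {e : Edge} (he : e ∈ S) :
    Measurable[sigmaEdges X S] (X e) :=
  (comap_measurable (X e)).mono
    (le_biSup (fun e => MeasurableSpace.comap (X e) inferInstance) he) le_rfl

variable [MeasurableSpace Ω] {P : Measure Ω}

theorem iIndepFun_proposal (hX : ∀ e, Measurable (X e)) (h : iIndepFun X P) (n : ℕ) (v : Vertex) :
    iIndepFun (fun i ω => proposal (fun e => X e ω) n v i) P :=
  iIndep_of_iIndep_of_le (iIndep_biSup_of_pairwise_disjoint (fun e => (hX e).comap_le) h.iIndep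
    (pairwise_disjoint_branch v)) fun _ =>
      (measurable_proposal n fun _ he => measurable_sigmaEdges he).comap_le

theorem indepFun_relVote_cons (hX : ∀ e, Measurable (X e)) (h : iIndepFun X P) (n : ℕ) (v : Vertex)
    (i : Fin 3) : IndepFun (X (v, i)) (fun ω => relVote (fun e => X e ω) n (i :: v)) P := by
  have hdisj : Disjoint {(v, i)} (edgesBelow (i :: v)) :=
    Set.disjoint_singleton_left.2 (notMem_edgesBelow_cons v i i)
  have hindep : Indep (sigmaEdges X {(v, i)}) (sigmaEdges X (edgesBelow (i :: v))) P :=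
    indep_iSup_of_disjoint (fun e => (hX e).comap_le) h.iIndep hdisj
  exact (IndepFun_iff_Indep _ _ _).2 <| indep_of_indep_of_le_left
    (indep_of_indep_of_le_right hindep
      (measurable_relVote n fun _ he => measurable_sigmaEdges he).comap_le)
    (measurable_sigmaEdges (Set.mem_singleton _)).comap_le

variable {μ : Measure ℝ}

theorem measureReal_relVote_le (hX : ∀ e, Measurable (X e)) (h : iIndepFun X P)
    (hμ : ∀ e, P.map (X e) = μ) (n : ℕ) (v : Vertex) (t : ℝ) :
    P.real {ω | relVote (fun e => X e ω) n v ≤ t} = majority (wave μ n t) := by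
  have := h.isProbabilityMeasure
  induction n generalizing v t with
  | zero => by_cases ht : 0 ≤ t <;> simp [relVote, wave, ht]
  | succ n ih =>
    refine measureReal_middle_le (fun i => measurable_proposal n fun e _ => hX e)
      (iIndepFun_proposal hX h n v) fun i => ?_
    have hadd := measureReal_add_le_eq_smear (hX (v, i)) (measurable_relVote n fun e _ => hX e)
      (indepFun_relVote_cons hX h n v i) t
    rwa [hμ, funext (ih (i :: v))] at hadd

theorem measureReal_M_le (hX : ∀ e, Measurable (X e)) (h : iIndepFun X P)
    (hμ : ∀ e, P.map (X e) = μ) (n : ℕ) (t : ℝ) :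
    P.real {ω | M X n ω ≤ t} = majority (wave μ n t) := by
  rw [M_eq_relVote]
  exact measureReal_relVote_le hX h hμ n [] t

end Law

section Tightness

theorem measureReal_lt_abs_M_le {Ω : Type*} [MeasurableSpace Ω] {P : Measure Ω}
    {X : Edge → Ω → ℝ} (hX : ∀ e, Measurable (X e)) (h : iIndepFun X P) {μ : Measure ℝ}
    (hμ : ∀ e, P.map (X e) = μ) {n : ℕ} (hw : IsSymmCdf (wave μ n)) {A : ℝ} (hA : 0 < A) :
    P.real {ω | A < |M X n ω|} ≤ 2 * wave μ n (-A) := by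
  have := h.isProbabilityMeasure
  have hsub : {ω | A < |M X n ω|} ⊆ {ω | M X n ω ≤ -A} ∪ {ω | M X n ω ≤ A}ᶜ := fun ω hω =>
    (lt_abs.1 hω).symm.imp (fun (h : A < -M X n ω) => (le_neg_of_le_neg h.le : M X n ω ≤ -A))
      fun (h : A < M X n ω) => (not_le.2 h : ¬M X n ω ≤ A)
  calc P.real {ω | A < |M X n ω|}
      ≤ P.real {ω | M X n ω ≤ -A} + P.real {ω | M X n ω ≤ A}ᶜ :=
        (measureReal_mono hsub).trans (measureReal_union_le _ _)
    _ = majority (wave μ n (-A)) + (1 - majority (wave μ n A)) := by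
        rw [probReal_compl_eq_one_sub (measurableSet_le (measurable_M hX n) measurable_const),
          measureReal_M_le hX h hμ, measureReal_M_le hX h hμ]
    _ ≤ 2 * majority (wave μ n (-A)) := by
        linarith [hw.majority_comp.one_le_add A (-A) (add_neg_cancel A).ge]
    _ ≤ 2 * wave μ n (-A) := by
        gcongr
        exact majority_le_self (hw.mem_Icc _).1 (hw.le_half (neg_lt_zero.2 hA))

theorem tendsto_tail_bound (E : ℝ) :
    Tendsto (fun A : ℝ => ENNReal.ofReal (2 * (2 * E / A) ^ (3⁻¹ : ℝ))) atTop (nhds 0) := by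
  have hdiv : Tendsto (fun A : ℝ => 2 * E / A) atTop (nhds 0) :=
    tendsto_const_nhds.div_atTop tendsto_id
  have hrpow := hdiv.rpow_const (p := (3⁻¹ : ℝ)) (Or.inr (by norm_num))
  rw [Real.zero_rpow (by norm_num)] at hrpow
  simpa using ENNReal.tendsto_ofReal (hrpow.const_mul 2)

theorem isNegInvariant_withDensity {q : ℝ → ℝ} (hs : ∀ y, q (-y) = q y) :
    (volume.withDensity fun y => ENNReal.ofReal (q y)).IsNegInvariant := by
  refine ⟨Measure.ext fun s hs' => ?_⟩
  rw [Measure.neg, Measure.map_apply measurable_neg hs',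
    withDensity_apply _ (measurable_neg hs'), withDensity_apply _ hs',
    ← lintegral_indicator (measurable_neg hs'), ← lintegral_indicator hs',
    ← lintegral_neg_eq_self]
  refine lintegral_congr fun y => ?_
  by_cases hy : y ∈ s <;> simp [Set.indicator, hy, hs]

theorem exists_ae_abs_le_of_hasCompactSupport {q : ℝ → ℝ} (hq : HasCompactSupport q)
    (hm : Measurable q) :
    ∃ R, ∀ᵐ y ∂(volume.withDensity fun y => ENNReal.ofReal (q y)), |y| ≤ R := by
  obtain ⟨R, hR⟩ := hq.isBounded.exists_norm_le
  refine ⟨R, (ae_withDensity_iff hm.ennreal_ofReal).2 (ae_of_all _ fun y hy => hR y ?_)⟩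
  exact subset_tsupport _ fun h0 => hy (by simp [h0])

theorem lowerDensity_univ : lowerDensity Set.univ = 1 := by
  refine Tendsto.liminf_eq (tendsto_const_nhds.congr' ?_)
  filter_upwards [eventually_ne_atTop 0] with n hn
  rw [Set.univ_inter, ← Finset.coe_Icc, Set.ncard_coe_finset, Nat.card_Icc, Nat.add_sub_cancel,
    div_self (Nat.cast_ne_zero.2 hn)]

end Tightness

end TernaryVoting

theorem theorem3p4_general {Ω : Type*} [MeasurableSpace Ω] {P : Measure Ω} {μ : Measure ℝ}
    [μ.IsNegInvariant] {R : ℝ} (hR : ∀ᵐ y ∂μ, |y| ≤ R) {X : TernaryVoting.Edge → Ω → ℝ}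
    (hX : ∀ e, Measurable (X e)) (h : iIndepFun X P) (hμ : ∀ e, P.map (X e) = μ) :
    IsTightMeasureSet (Set.range fun n => P.map (TernaryVoting.M X n)) := by
  have := h.isProbabilityMeasure
  have : IsProbabilityMeasure μ :=
    hμ ([], 0) ▸ Measure.isProbabilityMeasure_map (hX _).aemeasurable
  refine isTightMeasureSet_of_tendsto_measure_norm_gt <| tendsto_of_tendsto_of_tendsto_of_le_of_le'
    tendsto_const_nhds (TernaryVoting.tendsto_tail_bound (TernaryVoting.energy μ 0))
    (.of_forall fun _ => zero_le) ?_
  filter_upwards [eventually_gt_atTop 0] with A hA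
  refine iSup₂_le ?_
  rintro _ ⟨n, rfl⟩
  rw [Measure.map_apply (TernaryVoting.measurable_M hX n)
    (measurableSet_lt measurable_const measurable_norm), ← ofReal_measureReal]
  refine ENNReal.ofReal_le_ofReal ((TernaryVoting.measureReal_lt_abs_M_le hX h hμ
    (TernaryVoting.isSymmCdf_wave hR n) hA).trans ?_)
  gcongr
  exact TernaryVoting.wave_neg_le_rpow hR n hA

theorem theorem3p4 {Ω : Type*} [MeasurableSpace Ω] (P : Measure Ω) [IsProbabilityMeasure P]
    (q : ℝ → ℝ) (hq : TernaryVoting.IsJumpDensity q) (hq_symm : ∀ y, q (-y) = q y)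
    (X : TernaryVoting.Edge → Ω → ℝ) (hX : TernaryVoting.IsIncrementField P q X) :
    ∃ I : Set ℕ,
      IsTightMeasureSet {ν : Measure ℝ | ∃ n ∈ I, ν = P.map (TernaryVoting.M X n)} ∧
      0 < TernaryVoting.lowerDensity I := by
  have := TernaryVoting.isNegInvariant_withDensity hq_symm
  obtain ⟨R, hR⟩ := TernaryVoting.exists_ae_abs_le_of_hasCompactSupport hq.hasCompactSupport
    hq.continuous.measurable
  refine ⟨Set.univ, ?_, TernaryVoting.lowerDensity_univ ▸ one_pos⟩
  refine (theorem3p4_general hR hX.measurable hX.indep hX.law).subset ?_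
  rintro _ ⟨n, -, rfl⟩
  exact Set.mem_range_self n
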